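/- Let $p$ and $\ell$ be distinct primes, and let $K$ be a field complete with respect to a discrete valuation, with valuation ring $A$ and algebraically closed residue field of characteristic $p>0$ (the characteristic of $K$ itself is $0$ or $p$). Let $K'$ be a finite extension of $K$, with its unique extension of the valuation (so $K'$ is again a complete discretely valued field with algebraically closed residue field of characteristic $p$). Fix an algebraic closure $\bar K$ of $K$ containing $K'$, so that $\mathrm{Gal}(\bar K/K')\subset \mathrm{Gal}(\bar K/K)$. Let $\mathbb F$ be a finite field of characteristic $\ell$, let $r\ge 0$, put $V=\mathbb F^r$, and let $\rho:\mathrm{Gal}(\bar K/K)\to \mathrm{GL}_r(\mathbb F)$ be a continuous representation. Its Swan conductor is $$\mathrm{Sw}(\rho)=\sum_{i\ge 1}\frac{|G_i|}{|G_0|}\,\dim_{\mathbb F}\bigl(V/V^{G_i}\bigr),$$ where $L/K$ is the finite Galois extension cut out by $\ker\rho$, $G=\mathrm{Gal}(L/K)\cong \rho(\mathrm{Gal}(\bar K/K))$, and $G_i=\{\sigma\in G:\ \sigma x-x\in \mathfrak m_L^{\,i+1}\text{ for all }x\in\mathcal O_L\}$ are the ramification groups in the lower numbering; here $\mathcal O_L$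 is the integral closure of $A$ in $L$ and $\mathfrak m_L$ its maximal ideal. The Swan conductor over $K'$ is defined in the same way. If $N$ is a rational number with $\mathrm{Sw}(\rho)\le N$, then $$\mathrm{Sw}\bigl(\rho|_{\mathrm{Gal}(\bar K/K')}\bigr)\le [K':K]\cdot N .$$ -/

import Mathlib

namespace LocalSwan

open IsLocalRing

section Ramification

variable {K : Type*} [Field K]

/-- The ring of integers `O_L` of an algebraic extension `L` of a complete discretely valued field
`K` with valuation ring `A`: the integral closure of `A` in `L`. -/
abbrev integers (A : ValuationSubring K) (L : Type*) [Field L] [Algebra K L] : Subalgebra A L :=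
  integralClosure A L

/-- The maximal ideal of `O_L`. (As `A` is complete, `O_L` is a local ring, and the Jacobson radical
of a local ring is its maximal ideal.) -/
def maxIdeal (A : ValuationSubring K) (L : Type*) [Field L] [Algebra K L] :
    Ideal (integers A L) :=
  Ideal.jacobson ⊥

/-- The `i`-th ramification group, in the lower numbering, of a Galois extension `L` of `K`:
the `σ` in `Gal(L/K)` with `σ x - x ∈ m_L ^ (i + 1)` for all `x ∈ O_L`. -/
def ramificationGroup (A : ValuationSubring K) (L : Type*) [Field L] [Algebra K L] (i : ℕ) :
    Subgroup Gal(L/K) :=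
  (maxIdeal A L ^ (i + 1)).inertia Gal(L/K)

theorem mem_ramificationGroup (A : ValuationSubring K) (L : Type*) [Field L] [Algebra K L] (i : ℕ)
    (σ : Gal(L/K)) :
    σ ∈ ramificationGroup A L i ↔ ∀ x : integers A L, σ • x - x ∈ maxIdeal A L ^ (i + 1) :=
  Iff.rfl

end Ramification

section Swan

variable {K Ω : Type*} [Field K] [Field Ω] [Algebra K Ω] [IsAlgClosure K Ω]
  {F : Type*} [Field F] {r : ℕ}

/-- The Galois extension of `K` inside the algebraic closure `Ω` which is cut out by `ρ`: the
separable elements fixed by the kernel of `ρ`. For continuous `ρ` with finite image it is finite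
over `K`, and `ρ` induces an isomorphism of its Galois group with the image of `ρ`.
(When `K` is not perfect, the field fixed by the kernel also contains purely inseparable elements,
on which the Galois group acts trivially; hence the intersection.) -/
def splittingField (ρ : Gal(Ω/K) →* GL (Fin r) F) : IntermediateField K Ω :=
  IntermediateField.fixedField ρ.ker ⊓ separableClosure K Ω

instance splittingField_normal (ρ : Gal(Ω/K) →* GL (Fin r) F) : Normal K (splittingField ρ) := by
  have : Normal K Ω := IsAlgClosure.normal K Ω
  have h : Normal K (IntermediateField.fixedField ρ.ker) := by
    rw [IntermediateField.normal_iff_forall_map_le']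
    rintro σ _ ⟨x, hx, rfl⟩
    have hx' : ∀ f ∈ ρ.ker, f x = x := (IntermediateField.mem_fixedField_iff _ _).1 hx
    refine (IntermediateField.mem_fixedField_iff _ _).2 fun f hf => ?_
    have h1 : (σ⁻¹ * f * σ) x = x := hx' _ <| by
      simpa using (inferInstance : ρ.ker.Normal).conj_mem f hf σ⁻¹
    have h2 := congrArg σ h1
    simpa [AlgEquiv.mul_apply, AlgEquiv.aut_inv] using h2
  unfold splittingField
  infer_instance

/-- The subspace `V ^ H` of `V = F ^ r` fixed by a subgroup `H` of the Galois group acting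
through `ρ`. -/
def fixedSubspace (ρ : Gal(Ω/K) →* GL (Fin r) F) (H : Subgroup Gal(Ω/K)) :
    Submodule F (Fin r → F) where
  carrier := {v | ∀ σ ∈ H, (ρ σ : Matrix (Fin r) (Fin r) F).mulVec v = v}
  add_mem' ha hb σ hσ := by rw [Matrix.mulVec_add, ha σ hσ, hb σ hσ]
  zero_mem' σ _ := Matrix.mulVec_zero _
  smul_mem' c v hv σ hσ := by rw [Matrix.mulVec_smul, hv σ hσ]

/-- The Swan conductor of a continuous representation `ρ` of the Galois group of the complete
discretely valued field `K` (with valuation ring `A`):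
`∑_{i ≥ 1} |G_i| / |G_0| * dim (V / V ^ G_i)`, where `G = Gal(L/K)` for the finite Galois
extension `L` of `K` cut out by `ρ`, with its ramification groups `G_i` in the lower numbering.
Here `V ^ G_i` is expressed through the preimage of `G_i` in the absolute Galois group. The sum is
finite, because `G_i` is trivial for large `i`. -/
noncomputable def swanConductor (A : ValuationSubring K) (ρ : Gal(Ω/K) →* GL (Fin r) F) : ℚ :=
  ∑ᶠ i : ℕ,
    (Nat.card (ramificationGroup A (splittingField ρ) (i + 1)) : ℚ) /
      (Nat.card (ramificationGroup A (splittingField ρ) 0) : ℚ) *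
      (Module.finrank F ((Fin r → F) ⧸ fixedSubspace ρ
        ((ramificationGroup A (splittingField ρ) (i + 1)).comap
          (AlgEquiv.restrictNormalHom (splittingField ρ)))) : ℚ)

end Swan

end LocalSwan

/-! Let L/K and L'/K' be the extensions cut out by ρ and by its restriction, with groups G and G';
then L ⊆ L'. Put Φ(n) = (|G_1| + ... + |G_n|)/|G_0| and define Φ' in the same way (Herbrand
functions at integers). The heart is `sum_card_ramificationGroup_le`: if some s in G'_{m+1}
restricts to an element outside G_{n+1}, then Φ'(m+1) ≤ [K':K] Φ(n). Both residue fields are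
algebraically closed, so O_L and O_{L'} are generated by uniformizers π and π'. Write sπ' = π'θ_s
and gπ = πη_g; the ramification groups are read off from the valuations of θ_s - 1 and η_g - 1.
Expanding π = π'^ε u(π') over A' yields a polynomial P with P(θ_s) = υη_{s|L}, where υ = P(1) is a
unit. Hence ∏(X - θ_s) divides the product of the P - υη_g over g in G, and comparing contents after
X ↦ 1 + π'^{m+1}X (`sum_min_emultiplicity_le`) bounds |G'_1| + ... + |G'_{m+1}| by ε(|G_1| + ... +
|G_n|). Since ε ≤ [L':L] and both extensions are totally ramified, dividing by the degrees gives the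
estimate. The Swan conductors are then compared slice by slice in the dimension
(`sum_mul_le_of_partial_sums`): if V^{G'_{m+1}} has larger codimension than V^{G_{n+1}}, then
G'_{m+1} cannot restrict into G_{n+1}, so the estimate applies. -/

namespace LocalSwan

open IsLocalRing

/-! ### Locality of finite domains over a complete local ring -/

section CompleteRings

theorem isAdicComplete_of_linearEquiv {A M N : Type*} [CommRing A] [AddCommGroup M] [Module A M]
    [AddCommGroup N] [Module A N] (e : M ≃ₗ[A] N) (I : Ideal A) [h : IsAdicComplete I M] :
    IsAdicComplete I N := by
  have hN : ∀ n : ℕ, (I ^ n • ⊤ : Submodule A M).map (e : M →ₗ[A] N) = I ^ n • ⊤ := fun n => by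
    rw [Submodule.map_smul'', Submodule.map_top, LinearEquiv.range]
  have hM : ∀ n : ℕ, (I ^ n • ⊤ : Submodule A N).map (e.symm : N →ₗ[A] M) = I ^ n • ⊤ :=
    fun n => by rw [Submodule.map_smul'', Submodule.map_top, LinearEquiv.range]
  refine { haus' := fun x hx => ?_, prec' := fun f hf => ?_ }
  · refine e.symm.map_eq_zero_iff.1 (h.toIsHausdorff.haus' _ fun n => ?_)
    simpa [hM] using (hx n).map (e.symm : N →ₗ[A] M)
  · obtain ⟨m, hm⟩ := h.toIsPrecomplete.prec' (fun n => e.symm (f n)) fun hij => by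
      simpa [hM] using (hf hij).map (e.symm : N →ₗ[A] M)
    exact ⟨e m, fun n => by simpa [hN] using (hm n).map (e : M →ₗ[A] N)⟩

theorem isAdicComplete_pi {A ι : Type*} [CommRing A] [Finite ι] (I : Ideal A)
    [h : IsAdicComplete I A] [IsNoetherianRing A] : IsAdicComplete I (ι → A) := by
  classical
  have := Fintype.ofFinite ι
  have hmem : ∀ (n : ℕ) (v : ι → A), v ∈ (I ^ n • ⊤ : Submodule A (ι → A)) ↔ ∀ i, v i ∈ I ^ n := by
    intro n v
    constructor
    · intro hv i
      have := Submodule.mem_map_of_mem (f := LinearMap.proj (R := A) (φ := fun _ : ι => A) i) hv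
      rw [Submodule.map_smul''] at this
      simpa using Submodule.smul_mono le_rfl le_top this
    · intro hv
      rw [← Finset.univ_sum_single v]
      refine Submodule.sum_mem _ fun i _ => ?_
      have : (Pi.single i (v i) : ι → A) = v i • Pi.single i 1 := by
        rw [← Pi.single_smul, smul_eq_mul, mul_one]
      rw [this]
      exact Submodule.smul_mem_smul (hv i) trivial
  have hs : ∀ (n : ℕ) (v w : ι → A), v ≡ w [SMOD (I ^ n • ⊤ : Submodule A (ι → A))] ↔
      ∀ i, v i ≡ w i [SMOD (I ^ n • ⊤ : Submodule A A)] := by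
    intro n v w
    simp only [SModEq.sub_mem, hmem]
    simp
  refine { haus' := fun x hx => ?_, prec' := fun f hf => ?_ }
  · funext i
    exact h.toIsHausdorff.haus' _ fun n => (hs _ _ _).1 (hx n) i
  · choose L hL using fun i => h.toIsPrecomplete.prec' (fun n => f n i)
      fun hij => (hs _ _ _).1 (hf hij) i
    exact ⟨L, fun n => (hs _ _ _).2 fun i => hL i n⟩

theorem exists_mul_self_quotient {R : Type*} [CommRing R] [IsArtinianRing R] (x : R) :
    ∃ e : R, e * e = e ∧ (∀ P : Ideal R, P.IsPrime → (e ∈ P ↔ x ∈ P)) := by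
  obtain ⟨n, y, hy⟩ := IsArtinian.exists_pow_succ_smul_dvd x (1 : R)
  have hy' : x ^ n * (x * y) = x ^ n := by
    simpa [pow_succ, mul_assoc] using hy
  have hk : ∀ k : ℕ, x ^ n * (x * y) ^ k = x ^ n := by
    intro k
    induction k with
    | zero => simp
    | succ k ih => rw [pow_succ, ← mul_assoc, ih, hy']
  have hn : ∀ k : ℕ, (x * y) ^ n * (x * y) ^ k = (x * y) ^ n := fun k => by
    rw [mul_pow x y n, mul_right_comm, hk]
  -- The exponent is n + 1 rather than n so that x divides the idempotent even when n = 0.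
  refine ⟨(x * y) ^ (n + 1), ?_, fun P hP => ⟨fun h => ?_, fun h => ?_⟩⟩
  · have h2 : (x * y) ^ (n + 1) * (x * y) ^ (n + 1) = (x * y) ^ n * (x * y) ^ (n + 2) := by ring
    rw [h2, hn, pow_succ]
    simpa using (hn 1).symm
  · have h1 : x ^ n ∈ P := by
      rw [← hk (n + 1)]
      exact P.mul_mem_left _ h
    exact hP.mem_of_pow_mem _ h1
  · rw [pow_succ]
    exact P.mul_mem_left _ (P.mul_mem_right _ h)

theorem exists_mul_sub_one_eq_zero {B : Type*} [CommRing B] (I : Ideal B) [HenselianRing B I]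
    {e : B} (hee : e * e - e ∈ I) : ∃ a : B, a * (a - 1) = 0 ∧ a - e ∈ I := by
  -- Modulo I the derivative 2e - 1 of X² - X is its own inverse, as (2e - 1)² - 1 = 4(e² - e).
  have hunit : (2 * e - 1) * (2 * e - 1) - 1 ∈ I := by
    have := I.mul_mem_left 4 hee
    ring_nf at this ⊢
    exact this
  have hev : (Polynomial.X ^ 2 - Polynomial.X : Polynomial B).eval e ∈ I := by
    simpa [pow_two] using hee
  have hder : IsUnit (Ideal.Quotient.mk I
      ((Polynomial.X ^ 2 - Polynomial.X : Polynomial B).derivative.eval e)) := by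
    refine IsUnit.of_mul_eq_one (Ideal.Quotient.mk I (2 * e - 1)) ?_
    rw [← map_mul, ← map_one (Ideal.Quotient.mk I), Ideal.Quotient.eq]
    simpa [Polynomial.derivative_sub, one_add_one_eq_two] using hunit
  have hm : (Polynomial.X ^ 2 - Polynomial.X : Polynomial B).Monic := by
    nontriviality B
    refine (Polynomial.monic_X_pow 2).sub_of_left ?_
    rw [Polynomial.degree_X_pow, Polynomial.degree_X]
    norm_num
  obtain ⟨a, ha, hae⟩ := HenselianRing.is_henselian (I := I) _ hm e hev hder
  refine ⟨a, ?_, hae⟩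
  rw [Polynomial.IsRoot.def, Polynomial.eval_sub, Polynomial.eval_pow, Polynomial.eval_X] at ha
  rw [← ha]
  ring

/-- Two maximal ideals would be separated by an idempotent of the Artinian quotient. Its lift to the
domain B is 0 or 1, which separates nothing. -/
theorem isLocalRing_of_henselianRing {B : Type*} [CommRing B] [IsDomain B] (I : Ideal B)
    [hH : HenselianRing B I] [IsArtinianRing (B ⧸ I)] : IsLocalRing B := by
  have hle : ∀ P : Ideal B, P.IsMaximal → I ≤ P := fun P hP x hx =>
    Ideal.mem_sInf.1 (HenselianRing.jac hx) ⟨bot_le, hP⟩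
  obtain ⟨P, hP⟩ := Ideal.exists_maximal B
  refine IsLocalRing.of_unique_max_ideal ⟨P, hP, fun Q hQ => ?_⟩
  by_contra hne
  have : ¬ P ≤ Q := fun h => hne (hP.eq_of_le hQ.ne_top h).symm
  obtain ⟨x, hxP, hxQ⟩ := Set.not_subset.1 this
  obtain ⟨e', he, hmem⟩ := exists_mul_self_quotient (Ideal.Quotient.mk I x)
  obtain ⟨e, rfl⟩ := Ideal.Quotient.mk_surjective e'
  have key : ∀ P : Ideal B, P.IsMaximal → (e ∈ P ↔ x ∈ P) := fun P hP => by
    have hker : RingHom.ker (Ideal.Quotient.mk I) ≤ P := by simpa using hle P hP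
    have := hmem (P.map (Ideal.Quotient.mk I))
      (Ideal.map_isPrime_of_surjective Ideal.Quotient.mk_surjective hker)
    simpa [Ideal.mem_quotient_iff_mem (hle P hP)] using this
  have hee : e * e - e ∈ I := by
    rw [← Ideal.Quotient.eq, map_mul, he]
  obtain ⟨a, ha', hae⟩ := exists_mul_sub_one_eq_zero I hee
  rcases mul_eq_zero.1 ha' with h0 | h1
  · subst h0
    refine hxQ ((key Q hQ).1 ?_)
    simpa using hle Q hQ hae
  · rw [sub_eq_zero] at h1
    subst h1
    refine hP.ne_top ((Ideal.eq_top_iff_one _).2 ?_)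
    have := P.add_mem (hle P hP hae) ((key P hP).2 hxP)
    simpa using this

theorem isLocalRing_of_finite (A : Type*) {B : Type*} [CommRing A] [IsNoetherianRing A]
    [CommRing B] [Algebra A B] [Module.Finite A B] [IsLocalRing A]
    [IsAdicComplete (maximalIdeal A) A] [IsDomain B] [Module.Free A B] : IsLocalRing B := by
  have hc : IsAdicComplete (maximalIdeal A) B := by
    have := isAdicComplete_pi (ι := Fin (Module.finrank A B)) (maximalIdeal A)
    exact isAdicComplete_of_linearEquiv (Module.finBasis A B).equivFun.symm _
  let I := (maximalIdeal A).map (algebraMap A B)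
  have : IsAdicComplete I B := (IsAdicComplete.map_algebraMap_iff _ _).2 hc
  have hart : IsArtinianRing (B ⧸ I) := by
    have : Module.Finite (A ⧸ maximalIdeal A) (B ⧸ I) :=
      Module.Finite.of_restrictScalars_finite A _ _
    have : IsArtinianRing (A ⧸ maximalIdeal A) := by
      let := Ideal.Quotient.field (maximalIdeal A)
      infer_instance
    exact IsArtinianRing.of_finite (A ⧸ maximalIdeal A) _
  exact isLocalRing_of_henselianRing I

end CompleteRings

/-! ### Rings of integers generated by a uniformizer -/

section Uniformizer

/-- The residue extension is trivial, so π-adic expansion with digits in A gives B = A[π] + π^k B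
for every k. When π^k generates the extension of the maximal ideal of A, Nakayama finishes. -/
theorem adjoin_uniformizer_eq_top {A B : Type*} [CommRing A] [IsDomain A]
    [IsDiscreteValuationRing A] [IsAlgClosed (ResidueField A)] [CommRing B] [IsDomain B]
    [IsDiscreteValuationRing B] [Algebra A B] [Module.Finite A B] [FaithfulSMul A B] {π : B}
    (hπ : Irreducible π) : Algebra.adjoin A {π} = ⊤ := by
  have hloc : IsLocalHom (algebraMap A B) := Algebra.IsIntegral.isLocalHom A B
  have hres := (IsAlgClosed.algebraMap_bijective_of_isIntegral (k := ResidueField A)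
    (K := ResidueField B)).2
  have hstep : ∀ b : B, ∃ (a : A) (c : B), b = algebraMap A B a + π * c := by
    intro b
    obtain ⟨a', ha⟩ := hres (residue B b)
    obtain ⟨a, rfl⟩ := residue_surjective a'
    have h1 : residue B (b - algebraMap A B a) = 0 := by
      rw [map_sub, sub_eq_zero, ← ha]
      rfl
    rw [residue_eq_zero_iff, (IsDiscreteValuationRing.irreducible_iff_uniformizer _).1 hπ,
      Ideal.mem_span_singleton] at h1
    obtain ⟨c, hc⟩ := h1
    exact ⟨a, c, by rw [← hc]; ring⟩
  have hpow : ∀ (k : ℕ) (b : B), ∃ n ∈ Algebra.adjoin A {π}, ∃ c : B, b = n + π ^ k * c := by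
    intro k
    induction k with
    | zero => exact fun b => ⟨0, Subalgebra.zero_mem _, b, by simp⟩
    | succ k ih =>
      intro b
      obtain ⟨n, hn, c, rfl⟩ := ih b
      obtain ⟨a, d, rfl⟩ := hstep c
      refine ⟨n + π ^ k * algebraMap A B a, ?_, d, by ring⟩
      exact add_mem hn (mul_mem (pow_mem (Algebra.self_mem_adjoin_singleton A π) k)
        (Subalgebra.algebraMap_mem _ a))
  have hne : (maximalIdeal A).map (algebraMap A B) ≠ ⊥ := by
    rw [Ne, Ideal.map_eq_bot_iff_of_injective (FaithfulSMul.algebraMap_injective A B)]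
    exact IsDiscreteValuationRing.not_a_field A
  obtain ⟨k, hk⟩ := IsDiscreteValuationRing.ideal_eq_span_pow_irreducible hne hπ
  rw [← Algebra.toSubmodule_eq_top, eq_top_iff]
  refine Submodule.le_of_le_smul_of_le_jacobson_bot (I := maximalIdeal A)
    (Module.finite_def.1 inferInstance) (jacobson_eq_maximalIdeal ⊥ bot_ne_top).ge fun b _ => ?_
  obtain ⟨n, hn, c, rfl⟩ := hpow k b
  refine Submodule.add_mem_sup hn ?_
  rw [Ideal.smul_top_eq_map, Submodule.restrictScalars_mem, hk]
  exact Ideal.mul_mem_right _ _ (Ideal.mem_span_singleton_self _)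

theorem faithfulSMul_integers {K : Type*} [Field K] (A : ValuationSubring K) (L : Type*) [Field L]
    [Algebra K L] : FaithfulSMul A (integers A L) := inferInstance

variable {K : Type*} [Field K] (A : ValuationSubring K) [IsDiscreteValuationRing A]
  [IsAdicComplete (maximalIdeal A) A] (L : Type*) [Field L] [Algebra K L] [FiniteDimensional K L]
  [Algebra.IsSeparable K L]

theorem isDiscreteValuationRing_integers : IsDiscreteValuationRing (integers A L) := by
  have : Module.Finite A (integers A L) := IsIntegralClosure.finite A K L _
  have : IsDedekindDomain (integers A L) := integralClosure.isDedekindDomain A K L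
  have : Module.Free A (integers A L) := Module.free_of_finite_type_torsion_free'
  have : IsLocalRing (integers A L) := isLocalRing_of_finite A
  have hf : ¬ IsField (integers A L) := fun h =>
    IsDiscreteValuationRing.not_isField A
      (isField_of_isIntegral_of_isField (FaithfulSMul.algebraMap_injective A (integers A L)) h)
  have h : IsDiscreteValuationRing (integers A L) ↔ IsDedekindDomain (integers A L) :=
    (IsDiscreteValuationRing.TFAE _ hf).out 0 2
  exact h.2 inferInstance

theorem exists_uniformizer [IsAlgClosed (ResidueField A)] :
    ∃ π : integers A L, Irreducible π ∧ maxIdeal A L = Ideal.span {π} ∧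
      Algebra.adjoin A {π} = ⊤ := by
  have := isDiscreteValuationRing_integers A L
  have : Module.Finite A (integers A L) := IsIntegralClosure.finite A K L _
  have := faithfulSMul_integers A L
  obtain ⟨π, hπ⟩ := IsDiscreteValuationRing.exists_irreducible (integers A L)
  refine ⟨π, hπ, ?_, adjoin_uniformizer_eq_top hπ⟩
  rw [← (IsDiscreteValuationRing.irreducible_iff_uniformizer _).1 hπ]
  exact jacobson_eq_maximalIdeal ⊥ bot_ne_top

end Uniformizer

theorem mem_ramificationGroup_iff_dvd {K : Type*} [Field K] {A : ValuationSubring K}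
    {L : Type*} [Field L] [Algebra K L] {π : integers A L} (hm : maxIdeal A L = Ideal.span {π})
    (hadj : Algebra.adjoin A {π} = ⊤) (i : ℕ) (σ : Gal(L/K)) :
    σ ∈ ramificationGroup A L i ↔ π ^ (i + 1) ∣ σ • π - π := by
  rw [mem_ramificationGroup, hm, Ideal.span_singleton_pow]
  simp only [Ideal.mem_span_singleton]
  refine ⟨fun h => h π, fun h x => ?_⟩
  have hx : x ∈ Algebra.adjoin A {π} := hadj ▸ Algebra.mem_top
  induction hx using Algebra.adjoin_induction with
  | mem x hx => rwa [Set.mem_singleton_iff.1 hx]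
  | algebraMap a => simp
  | add x y _ _ hx hy =>
    rw [smul_add, add_sub_add_comm]
    exact dvd_add hx hy
  | mul x y _ _ hx hy =>
    have : σ • (x * y) - x * y = σ • x * (σ • y - y) + y * (σ • x - x) := by
      rw [smul_mul']; ring
    rw [this]
    exact dvd_add (hy.mul_left _) (hx.mul_left _)

/-! ### The content estimate -/

section PolynomialEstimate

open Polynomial

variable {B : Type*} [CommRing B] [IsDomain B]

theorem prod_X_sub_C_dvd_of_eval_eq_zero {S : Type*} [Fintype S] {θ : S → B}
    (hθ : Function.Injective θ) {f : B[X]} (hf : ∀ s, f.eval (θ s) = 0) :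
    ∏ s, (X - C (θ s)) ∣ f := by
  rcases eq_or_ne f 0 with rfl | hne
  · exact dvd_zero _
  have h := (Multiset.prod_X_sub_C_dvd_iff_le_roots hne (Finset.univ.val.map θ)).2 <| by
    refine (Multiset.le_iff_subset ((Multiset.nodup_map_iff_of_injective hθ).2
      Finset.univ.nodup)).2 fun x hx => ?_
    obtain ⟨s, -, rfl⟩ := Multiset.mem_map.1 hx
    exact (mem_roots hne).2 (hf s)
  rwa [Multiset.map_map] at h

omit [IsDomain B] in
theorem emultiplicity_C_C (a b : B) : emultiplicity (C a) (C b) = emultiplicity a b :=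
  emultiplicity_eq_emultiplicity_iff.2 fun {n} => by
    rw [← C_pow]
    exact ⟨fun h => by simpa using map_dvd (evalRingHom 0) h, fun h => map_dvd C h⟩

/-- The constant ϖ stays prime in B[X], so its multiplicity is additive on products and monotone
under divisibility. Substituting 1 + ϖ^J X makes the contents of the linear factors see θ t - 1 only
up to level J; on the other side, contents are bounded above through values at two points. -/
theorem sum_min_emultiplicity_le {ϖ : B} (hϖ : Prime ϖ) {S T : Type*} [Fintype S] [Fintype T]
    {θ : S → B} (hθ : Function.Injective θ) (η : T → B) (res : S → T) {υ : B} (hυ : ¬ ϖ ∣ υ)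
    {P : B[X]} (hP1 : P.eval 1 = υ) (hP : ∀ s, P.eval (θ s) = υ * η (res s)) {s : S} {J : ℕ}
    (hJ : ϖ ^ J ∣ θ s - 1) :
    ∑ t, min (J : ℕ∞) (emultiplicity ϖ (θ t - 1)) ≤
      ∑ t, min (emultiplicity ϖ (η (res s) - 1)) (emultiplicity ϖ (η t - 1)) := by
  have hC : Prime (C ϖ) := prime_C_iff.2 hϖ
  obtain ⟨y, hy⟩ := hJ
  let Z : B[X] := 1 + C (ϖ ^ J) * X
  have hdvd : ∏ t, (X - C (θ t)) ∣ ∏ t, (P - C (υ * η t)) := by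
    refine prod_X_sub_C_dvd_of_eval_eq_zero hθ fun t => ?_
    rw [eval_prod]
    exact Finset.prod_eq_zero (Finset.mem_univ (res t)) (by simp [hP])
  have hdvd' : ∏ t, (X - C (θ t)).comp Z ∣ ∏ t, (P - C (υ * η t)).comp Z := by
    have := map_dvd (compRingHom Z) hdvd
    simpa only [map_prod, coe_compRingHom_apply] using this
  have hmain := emultiplicity_le_emultiplicity_of_dvd_right (a := C ϖ) hdvd'
  rw [Finset.emultiplicity_prod hC, Finset.emultiplicity_prod hC] at hmain
  refine (Finset.sum_le_sum fun t _ => ?_).trans (hmain.trans (Finset.sum_le_sum fun t _ => ?_))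
  · have h1 : (X - C (θ t)).comp Z = C (ϖ ^ J) * X + C (-(θ t - 1)) := by
      simp [Z]; ring
    rw [h1]
    refine le_trans (min_le_min ?_ ?_) min_le_emultiplicity_add
    · exact le_emultiplicity_of_pow_dvd (by rw [C_pow]; exact dvd_mul_right _ _)
    · rw [emultiplicity_C_C, emultiplicity_neg]
  · have heval : ∀ (k : ℕ) (x : B), C ϖ ^ k ∣ (P - C (υ * η t)).comp Z →
        ϖ ^ k ∣ P.eval (1 + ϖ ^ J * x) - υ * η t := fun k x h => by
      have := map_dvd (evalRingHom x) h
      simpa [Z, eval_comp] using this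
    have h1 : ∀ k : ℕ, C ϖ ^ k ∣ (P - C (υ * η t)).comp Z → ϖ ^ k ∣ η t - 1 := fun k h => by
      have h2 := heval k 0 h
      rw [mul_zero, add_zero, hP1] at h2
      refine hϖ.pow_dvd_of_dvd_mul_left k hυ ?_
      rw [← dvd_neg]
      convert h2 using 1
      ring
    refine le_min (emultiplicity_le_emultiplicity_iff.2 fun k h => ?_)
      (emultiplicity_le_emultiplicity_iff.2 h1)
    -- The point y is chosen so that 1 + ϖ^J y = θ s; the point 0 gave the bound by η t - 1.
    have h2 := heval k y h
    rw [← hy, add_sub_cancel, hP] at h2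
    have h3 : ϖ ^ k ∣ η (res s) - η t := by
      refine hϖ.pow_dvd_of_dvd_mul_left k hυ ?_
      rwa [mul_sub]
    simpa using dvd_add h3 (h1 k h)

end PolynomialEstimate

/-! ### Level sets and weighted sums -/

section Counting

/-- Counting elements of the sets `{t | i < f t}` for `i < m`. -/
theorem sum_range_card_lt {T : Type*} [Fintype T] (f : T → ℕ∞) (m : ℕ) :
    ((∑ i ∈ Finset.range m, Nat.card {t // ((i + 1 : ℕ) : ℕ∞) ≤ f t} : ℕ) : ℕ∞) =
      ∑ t, min (m : ℕ∞) (f t) := by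
  classical
  have hcount : ∀ x : ℕ∞, min (m : ℕ∞) x =
      ((∑ i ∈ Finset.range m, if ((i + 1 : ℕ) : ℕ∞) ≤ x then 1 else 0 : ℕ) : ℕ∞) := by
    intro x
    induction m with
    | zero => simp
    | succ m ih =>
      rw [Finset.sum_range_succ, Nat.cast_add (∑ _ ∈ _, _), ← ih]
      split_ifs with h
      · rw [min_eq_left h, min_eq_left (le_trans (by exact_mod_cast Nat.le_succ m) h)]
        simp
      · have hx : x ≤ m := Order.le_of_lt_add_one (by simpa using h)
        rw [min_eq_right hx, min_eq_right (hx.trans (by exact_mod_cast Nat.le_succ m))]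
        simp
  simp_rw [hcount]
  rw [← Nat.cast_sum, Finset.sum_comm]
  congr 1
  refine Finset.sum_congr rfl fun i _ => ?_
  rw [Nat.card_eq_fintype_card, Fintype.card_subtype, Finset.card_filter]

/-- A comparison of weighted sums, by summation over the level sets of the weights. -/
theorem sum_mul_le_of_partial_sums {a b : ℕ → ℚ} {c d : ℕ → ℕ} (hb : ∀ i, 0 ≤ b i) {κ : ℚ}
    (ha : ∀ i, 0 ≤ a i) (hκ : 0 ≤ κ) {M N : ℕ} (hd : ∀ i, N ≤ i → d i = 0)
    (h : ∀ m n, d n < c m → ∑ i ∈ Finset.range (m + 1), a i ≤ κ * ∑ i ∈ Finset.range n, b i) :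
    ∑ i ∈ Finset.range M, a i * c i ≤ κ * ∑ i ∈ Finset.range N, b i * d i := by
  classical
  obtain ⟨D, hcD, hdD⟩ : ∃ D, (∀ i ∈ Finset.range M, c i ≤ D) ∧ ∀ i ∈ Finset.range N, d i ≤ D :=
    ⟨(Finset.range M).sup c + (Finset.range N).sup d,
      fun i hi => (Finset.le_sup hi).trans (Nat.le_add_right _ _),
      fun i hi => (Finset.le_sup hi).trans (Nat.le_add_left _ _)⟩
  have hlayer : ∀ (x : ℚ) (k : ℕ), k ≤ D →
      x * k = ∑ t ∈ Finset.range D, if t < k then x else 0 := fun x k hk => by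
    rw [← Finset.sum_filter, Finset.sum_const]
    have : (Finset.range D).filter (· < k) = Finset.range k := by
      ext t; simp; omega
    rw [this, Finset.card_range, nsmul_eq_mul, mul_comm]
  rw [Finset.sum_congr rfl fun i hi => hlayer (a i) (c i) (hcD i hi),
    Finset.sum_congr rfl fun i hi => hlayer (b i) (d i) (hdD i hi), Finset.sum_comm,
    Finset.sum_comm (s := Finset.range N), Finset.mul_sum]
  refine Finset.sum_le_sum fun t _ => ?_
  rw [← Finset.sum_filter, ← Finset.sum_filter]
  have hnn : 0 ≤ κ * ∑ i ∈ (Finset.range N).filter (fun i => t < d i), b i :=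
    mul_nonneg hκ (Finset.sum_nonneg fun i _ => hb i)
  rcases ((Finset.range M).filter fun i => t < c i).eq_empty_or_nonempty with he | hne
  · rw [he, Finset.sum_empty]
    exact hnn
  obtain ⟨m, hm, hmax⟩ := Finset.exists_max_image _ id hne
  have hex : ∃ n, d n ≤ t := ⟨N, by simp [hd N le_rfl]⟩
  have hspec := Nat.find_spec hex
  -- Here m is the last index with t < c m and `Nat.find hex` the first n with d n ≤ t, so no
  -- monotonicity of c or d is needed.
  calc _ ≤ ∑ i ∈ Finset.range (m + 1), a i :=
        Finset.sum_le_sum_of_subset_of_nonneg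
          (fun i hi => Finset.mem_range.2 (Nat.lt_succ_of_le (hmax i hi))) fun i _ _ => ha i
    _ ≤ κ * ∑ i ∈ Finset.range (Nat.find hex), b i :=
        h m _ (hspec.trans_lt (Finset.mem_filter.1 hm).2)
    _ ≤ _ := by
        refine mul_le_mul_of_nonneg_left (Finset.sum_le_sum_of_subset_of_nonneg (fun i hi => ?_)
          fun i _ _ => hb i) hκ
        have hi' := Nat.find_min hex (Finset.mem_range.1 hi)
        refine Finset.mem_filter.2 ⟨Finset.mem_range.2 ?_, not_le.1 hi'⟩
        by_contra hN
        exact hi' (by simp [hd i (not_lt.1 hN)])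

end Counting

open Polynomial

/-! ### Ramification groups through the quotients σπ/π -/

section Quotients

variable {K L : Type*} [Field K] [Field L] [Algebra K L] {A : ValuationSubring K}

theorem smul_coe (σ : Gal(L/K)) (x : integers A L) : ((σ • x : integers A L) : L) = σ x := rfl

theorem smul_injective_of_adjoin_eq_top [FiniteDimensional K L] {π : integers A L}
    (hadj : Algebra.adjoin A {π} = ⊤) : Function.Injective fun σ : Gal(L/K) => σ • π := by
  intro σ τ h
  have h1 : MulSemiringAction.toAlgHom A (integers A L) σ = MulSemiringAction.toAlgHom A _ τ :=
    AlgHom.ext_of_adjoin_eq_top hadj fun x hx => by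
      rw [Set.mem_singleton_iff.1 hx]
      exact h
  have h2 : ∀ b : integers A L, σ (b : L) = τ b := fun b =>
    congrArg Subtype.val (DFunLike.congr_fun h1 b)
  have : IsFractionRing (integers A L) L :=
    integralClosure.isFractionRing_of_finite_extension K L
  ext x
  obtain ⟨a, b, -, rfl⟩ := IsFractionRing.div_surjective (A := integers A L) x
  rw [map_div₀, map_div₀]
  exact congrArg₂ (· / ·) (h2 a) (h2 b)

theorem exists_smul_eq_mul_uniformizer [IsDiscreteValuationRing (integers A L)] [FiniteDimensional K L]
    {π : integers A L} (hπ : Irreducible π) (hm : maxIdeal A L = Ideal.span {π})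
    (hadj : Algebra.adjoin A {π} = ⊤) :
    ∃ θ : Gal(L/K) → integers A L, (∀ σ, σ • π = π * θ σ) ∧ Function.Injective θ ∧
      ∀ i σ, σ ∈ ramificationGroup A L i ↔ π ^ i ∣ θ σ - 1 := by
  have h1 : ∀ σ : Gal(L/K), ∃ θ, σ • π = π * θ := fun σ =>
    (IsDiscreteValuationRing.associated_of_irreducible _ hπ
      ((MulEquiv.irreducible_iff (MulSemiringAction.toRingEquiv Gal(L/K) (integers A L) σ)).2
        hπ)).dvd
  choose θ hθ using h1
  refine ⟨θ, hθ, fun σ τ h => smul_injective_of_adjoin_eq_top hadj ?_, fun i σ => ?_⟩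
  · simp only [hθ, h]
  · rw [mem_ramificationGroup_iff_dvd hm hadj, hθ, pow_succ', ← mul_sub_one]
    exact mul_dvd_mul_iff_left hπ.ne_zero

end Quotients

/-! ### Uniformizers in an extension of discrete valuation rings -/

section Extension

variable {B B' : Type*} [CommRing B] [IsDomain B] [IsDiscreteValuationRing B] [CommRing B']
  [IsDomain B'] (ι : B →+* B') {π : B} {π' : B'}
  {ε : ℕ} {υ : B'}

theorem emultiplicity_map_le (hπ : Irreducible π) (hπ' : Irreducible π') (hυ : IsUnit υ)
    (hι : ι π = π' ^ ε * υ) {x : B} {k : ℕ} (hx : ¬ π ^ (k + 1) ∣ x) :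
    emultiplicity π' (ι x) ≤ (ε : ℕ∞) * k := by
  have hx0 : x ≠ 0 := by
    rintro rfl
    exact hx (dvd_zero _)
  obtain ⟨j, u, rfl⟩ := IsDiscreteValuationRing.eq_unit_mul_pow_irreducible hx0 hπ
  have hj : j ≤ k := by
    by_contra hj
    exact hx ((pow_dvd_pow π (not_le.1 hj)).mul_left _)
  have h1 : ¬ π' ^ (ε * k + 1) ∣ ι (u * π ^ j) := by
    intro h
    have h2 : ι (u * π ^ j) = π' ^ (ε * j) * (ι u * υ ^ j) := by
      rw [map_mul, map_pow, hι]; ring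
    have h3 := (pow_dvd_pow π' (Nat.succ_le_succ (Nat.mul_le_mul_left ε hj))).trans h
    rw [h2, pow_succ, mul_dvd_mul_iff_left (pow_ne_zero _ hπ'.ne_zero)] at h3
    exact hπ'.not_isUnit (isUnit_of_dvd_unit h3 ((u.isUnit.map ι).mul (hυ.pow j)))
  rw [← emultiplicity_lt_iff_not_dvd] at h1
  exact Order.le_of_lt_add_one (by exact_mod_cast h1)

/-- At the first i where c i is a unit, the term has π'-valuation exactly i. Earlier terms are
divisible by π'^ε and later ones by π'^(i+1), so nothing can cancel it. -/
theorem dvd_of_sum_mul_pow_eq_zero (hπ : Irreducible π) (hπ' : Irreducible π')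
    (hι : ι π = π' ^ ε * υ) (c : Fin ε → B) (hc : ∑ i, ι (c i) * π' ^ (i : ℕ) = 0) (i : Fin ε) :
    π ∣ c i := by
  by_contra hi
  obtain ⟨i, hi, hmin⟩ : ∃ i, ¬ π ∣ c i ∧ ∀ j < i, π ∣ c j := by
    have hwf := (inferInstance : WellFoundedLT (Fin ε)).wf
    refine ⟨hwf.min {i | ¬ π ∣ c i} ⟨i, hi⟩, hwf.min_mem {i | ¬ π ∣ c i} ⟨i, hi⟩, fun j hj => ?_⟩
    by_contra hj'
    exact hwf.not_lt_min _ hj' hj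
  have hu : IsUnit (c i) := by
    by_contra hu
    refine hi ?_
    rwa [← Ideal.mem_span_singleton,
      ← (IsDiscreteValuationRing.irreducible_iff_uniformizer _).1 hπ, mem_maximalIdeal]
  have h1 : π' ^ ((i : ℕ) + 1) ∣ ι (c i) * π' ^ (i : ℕ) := by
    rw [← Finset.add_sum_erase _ _ (Finset.mem_univ i), add_eq_zero_iff_eq_neg] at hc
    rw [hc, dvd_neg]
    refine Finset.dvd_sum fun j hj => ?_
    rcases lt_or_gt_of_ne (Finset.ne_of_mem_erase hj) with hji | hji
    · refine Dvd.dvd.mul_right ?_ _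
      refine (pow_dvd_pow π' (Nat.succ_le_of_lt i.2)).trans ?_
      exact (Dvd.intro _ hι.symm).trans (map_dvd ι (hmin j hji))
    · exact (pow_dvd_pow π' (Nat.succ_le_of_lt hji)).mul_left _
  rw [pow_succ', mul_dvd_mul_iff_right (pow_ne_zero _ hπ'.ne_zero)] at h1
  exact hπ'.not_isUnit (isUnit_of_dvd_unit h1 (hu.map ι))

theorem eq_zero_of_sum_mul_pow_eq_zero (hπ : Irreducible π) (hπ' : Irreducible π')
    (hι0 : ι π ≠ 0) (hι : ι π = π' ^ ε * υ) (c : Fin ε → B)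
    (hc : ∑ i, ι (c i) * π' ^ (i : ℕ) = 0) (i : Fin ε) : c i = 0 := by
  have key : ∀ (k : ℕ) (c : Fin ε → B), ∑ i, ι (c i) * π' ^ (i : ℕ) = 0 → ∀ i, π ^ k ∣ c i := by
    intro k
    induction k with
    | zero => simp
    | succ k ih =>
      intro c hc i
      choose d hd using dvd_of_sum_mul_pow_eq_zero ι hπ hπ' hι c hc
      have h2 : ∑ i, ι (d i) * π' ^ (i : ℕ) = 0 := by
        refine (mul_eq_zero.1 ?_).resolve_left hι0
        rw [← hc, Finset.mul_sum]
        refine Finset.sum_congr rfl fun j _ => ?_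
        rw [hd j, map_mul, mul_assoc]
      rw [hd i, pow_succ']
      exact mul_dvd_mul_left _ (ih d h2 i)
  by_contra hne
  obtain ⟨j, u, hj⟩ := IsDiscreteValuationRing.eq_unit_mul_pow_irreducible hne hπ
  have h1 := key (j + 1) c hc i
  rw [hj, pow_succ', mul_dvd_mul_iff_right (pow_ne_zero _ hπ.ne_zero)] at h1
  exact hπ.not_isUnit (isUnit_of_dvd_unit h1 u.isUnit)

end Extension

/-! ### Comparison of the ramification filtrations of L/K and L'/K' -/

section Comparison

variable {K K' L L' : Type*} [Field K] [Field K'] [Field L] [Field L'] [Algebra K K']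
  [Algebra K L] [Algebra K' L'] [Algebra L L'] [Algebra K L'] [IsScalarTower K K' L']
  [IsScalarTower K L L'] {A : ValuationSubring K} {A' : ValuationSubring K'}

/-- The map between rings of integers induced by a map of extensions. -/
theorem exists_integers_ringHom (hAA' : ∀ a ∈ A, algebraMap K K' a ∈ A') :
    ∃ ι : integers A L →+* integers A' L', ∀ x, ((ι x : integers A' L') : L') = algebraMap L L' x := by
  let φ : A →+* A' := ((algebraMap K K').comp (algebraMap A K)).codRestrict A'.toSubring
    fun a => hAA' a a.2
  have h : ∀ x : integers A L, algebraMap L L' x ∈ integers A' L' := fun x => by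
    refine IsIntegral.map_of_comp_eq φ (algebraMap L L') ?_ x.2
    ext a
    change algebraMap K' L' (algebraMap K K' a) = algebraMap L L' (algebraMap K L a)
    rw [← IsScalarTower.algebraMap_apply, ← IsScalarTower.algebraMap_apply]
  exact ⟨((algebraMap L L').comp (algebraMap (integers A L) L)).codRestrict _ h, fun x => rfl⟩

/-- The powers 1, π', ..., π'^(ε-1) are linearly independent over L. -/
theorem ramification_exponent_le_finrank {B B' : Type*} [CommRing B] [IsDomain B]
    [IsDiscreteValuationRing B] [CommRing B'] [IsDomain B'] [Algebra B L] [IsFractionRing B L]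
    [Algebra B' L'] [FaithfulSMul B' L'] [FiniteDimensional L L'] (ι : B →+* B')
    (hcomp : ∀ x, algebraMap B' L' (ι x) = algebraMap L L' (algebraMap B L x)) {π : B} {π' : B'}
    (hπ : Irreducible π) (hπ' : Irreducible π') {ε : ℕ} {υ : B'} (hι0 : ι π ≠ 0)
    (hι : ι π = π' ^ ε * υ) : ε ≤ Module.finrank L L' := by
  let : Algebra B L' := ((algebraMap L L').comp (algebraMap B L)).toAlgebra
  have : IsScalarTower B L L' := IsScalarTower.of_algebraMap_eq fun _ => rfl
  have hli : LinearIndependent B fun i : Fin ε => algebraMap B' L' π' ^ (i : ℕ) := by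
    rw [Fintype.linearIndependent_iff]
    intro c hc
    refine eq_zero_of_sum_mul_pow_eq_zero ι hπ hπ' hι0 hι c ?_
    apply FaithfulSMul.algebraMap_injective B' L'
    rw [map_zero, ← hc, map_sum]
    refine Finset.sum_congr rfl fun i _ => ?_
    rw [map_mul, hcomp, map_pow, Algebra.smul_def]
    rfl
  have hli' := (LinearIndependent.iff_fractionRing B L).1 hli
  simpa using hli'.fintype_card_le_finrank

theorem sum_card_ramificationGroup_le [FiniteDimensional K L] [IsGalois K L]
    [FiniteDimensional K' L'] [IsGalois K' L'] [FiniteDimensional K K']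
    [IsDiscreteValuationRing A] [IsAdicComplete (maximalIdeal A) A]
    [IsDiscreteValuationRing A'] [IsAdicComplete (maximalIdeal A') A']
    [IsAlgClosed (ResidueField A)] [IsAlgClosed (ResidueField A')]
    (hAA' : ∀ a ∈ A, algebraMap K K' a ∈ A') (res : Gal(L'/K') → Gal(L/K))
    (hres : ∀ s x, algebraMap L L' (res s x) = s (algebraMap L L' x)) (m n : ℕ)
    (s : Gal(L'/K')) (hs : s ∈ ramificationGroup A' L' (m + 1))
    (hs' : res s ∉ ramificationGroup A L (n + 1)) :
    ∑ i ∈ Finset.range (m + 1), (Nat.card (ramificationGroup A' L' (i + 1)) : ℚ) /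
      (Nat.card (ramificationGroup A' L' 0) : ℚ) ≤ (Module.finrank K K' : ℚ) *
    ∑ i ∈ Finset.range n, (Nat.card (ramificationGroup A L (i + 1)) : ℚ) /
      (Nat.card (ramificationGroup A L 0) : ℚ) := by
  classical
  have := isDiscreteValuationRing_integers A L
  have := isDiscreteValuationRing_integers A' L'
  obtain ⟨π, hπ, hm, hadj⟩ := exists_uniformizer A L
  obtain ⟨π', hπ', hm', hadj'⟩ := exists_uniformizer A' L'
  obtain ⟨η, hη, -, hηmem⟩ := exists_smul_eq_mul_uniformizer hπ hm hadj
  obtain ⟨θ, hθ, hθinj, hθmem⟩ := exists_smul_eq_mul_uniformizer hπ' hm' hadj'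
  obtain ⟨ι, hι⟩ := exists_integers_ringHom (L := L) (L' := L') hAA'
  have hιinj : Function.Injective ι := fun x y h => by
    have := congrArg (Subtype.val) h
    rw [hι, hι] at this
    exact Subtype.val_injective ((algebraMap L L').injective this)
  have hιres : ∀ s x, ι (res s • x) = s • ι x := fun s x => by
    apply Subtype.val_injective
    rw [hι, smul_coe, hres, smul_coe, hι]
  have hι0 : ι π ≠ 0 := (map_ne_zero_iff ι hιinj).2 hπ.ne_zero
  obtain ⟨ε, υ, hυ⟩ := IsDiscreteValuationRing.eq_unit_mul_pow_irreducible hι0 hπ'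
  have hιπ : ι π = π' ^ ε * υ := by rw [hυ, mul_comm]
  obtain ⟨u, hu⟩ : ∃ u : A'[X], aeval π' u = (υ : integers A' L') := by
    have h : (υ : integers A' L') ∈ Algebra.adjoin A' {π'} := hadj' ▸ Algebra.mem_top
    rw [Algebra.adjoin_singleton_eq_range_aeval] at h
    exact h
  -- Here P(z) = z^ε u(π'z). Since π'θ_t = tπ' and t fixes the coefficients of u, π'^ε P(θ_t) =
  -- t(π'^ε υ) = t(ι π).
  let P : (integers A' L')[X] := X ^ ε * (u.map (algebraMap A' (integers A' L'))).comp (C π' * X)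
  have hP : ∀ z, P.eval z = z ^ ε * aeval (π' * z) u := fun z => by
    simp [P, eval_comp, aeval_def, eval_map]
  have hPθ : ∀ t, P.eval (θ t) = υ * ι (η (res t)) := fun t => by
    have h1 : aeval (π' * θ t) u = t • (υ : integers A' L') := by
      rw [← hθ, ← hu]
      exact (aeval_algHom_apply (MulSemiringAction.toAlgHom A' (integers A' L') t) π' u)
    rw [hP, h1]
    refine mul_left_cancel₀ (pow_ne_zero ε hπ'.ne_zero) ?_
    rw [← mul_assoc, ← mul_pow, ← hθ, ← smul_pow', ← smul_mul', ← mul_assoc, ← hιπ, ← hιres, hη,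
      map_mul]
  have hmain := sum_min_emultiplicity_le hπ'.prime hθinj (ι ∘ η) res
    (fun h => hπ'.not_isUnit (isUnit_of_dvd_unit h υ.isUnit)) (by rw [hP]; simpa using hu) hPθ
    (s := s) (J := m + 1) ((hθmem _ _).1 hs)
  have hbound : ∀ (t : Gal(L/K)) (k : ℕ), t ∉ ramificationGroup A L (k + 1) →
      emultiplicity π' (ι (η t) - 1) ≤ (ε : ℕ∞) * k := fun t k ht => by
    rw [← map_one ι, ← map_sub]
    exact emultiplicity_map_le ι hπ hπ' υ.isUnit hιπ fun h => ht ((hηmem _ _).2 h)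
  have hle : ∀ t : Gal(L/K), min (emultiplicity π' (ι (η (res s)) - 1))
      (emultiplicity π' (ι (η t) - 1)) ≤ ε * min (n : ℕ∞) (emultiplicity π (η t - 1)) := by
    intro t
    rcases le_or_gt (n : ℕ∞) (emultiplicity π (η t - 1)) with h | h
    · rw [min_eq_left h]
      exact (min_le_left _ _).trans (hbound _ _ hs')
    · rw [min_eq_right h.le]
      obtain ⟨k, hk⟩ := ENat.ne_top_iff_exists.1 h.ne_top
      rw [← hk]
      refine (min_le_right _ _).trans (hbound _ _ fun h' => ?_)
      have := le_emultiplicity_of_pow_dvd ((hηmem _ _).1 h')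
      rw [← hk] at this
      exact absurd (Nat.cast_le.1 this) (by omega)
  have hcard : ∀ i, Nat.card {t // ((i + 1 : ℕ) : ℕ∞) ≤ emultiplicity π (η t - 1)} =
      Nat.card (ramificationGroup A L (i + 1)) := fun i =>
    Nat.card_congr (Equiv.subtypeEquivRight fun t => by
      rw [hηmem, pow_dvd_iff_le_emultiplicity])
  have hcard' : ∀ i, Nat.card {t // ((i + 1 : ℕ) : ℕ∞) ≤ emultiplicity π' (θ t - 1)} =
      Nat.card (ramificationGroup A' L' (i + 1)) := fun i =>
    Nat.card_congr (Equiv.subtypeEquivRight fun t => by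
      rw [hθmem, pow_dvd_iff_le_emultiplicity])
  have hsum : ∑ i ∈ Finset.range (m + 1), Nat.card (ramificationGroup A' L' (i + 1)) ≤
      ε * ∑ i ∈ Finset.range n, Nat.card (ramificationGroup A L (i + 1)) := by
    have h := hmain.trans (Finset.sum_le_sum fun t _ => hle t)
    rw [← Finset.mul_sum, ← sum_range_card_lt, ← sum_range_card_lt] at h
    simp only [hcard, hcard'] at h
    exact_mod_cast h
  -- Total ramification: sending π to a multiple of π is already the condition for index 0.
  have h0 : Nat.card (ramificationGroup A L 0) = Module.finrank K L := by
    have : ramificationGroup A L 0 = ⊤ := eq_top_iff.2 fun t _ => (hηmem _ _).2 (by simp)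
    rw [this, Subgroup.card_top, IsGalois.card_aut_eq_finrank]
  have h0' : Nat.card (ramificationGroup A' L' 0) = Module.finrank K' L' := by
    have : ramificationGroup A' L' 0 = ⊤ := eq_top_iff.2 fun t _ => (hθmem _ _).2 (by simp)
    rw [this, Subgroup.card_top, IsGalois.card_aut_eq_finrank]
  have : FiniteDimensional K L' := FiniteDimensional.trans K K' L'
  have : FiniteDimensional L L' := FiniteDimensional.right K L L'
  have : IsFractionRing (integers A L) L :=
    integralClosure.isFractionRing_of_finite_extension K L
  have hε : ε ≤ Module.finrank L L' :=
    ramification_exponent_le_finrank ι hι hπ hπ' hι0 hιπ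
  have hdeg : ε * Module.finrank K L ≤ Module.finrank K K' * Module.finrank K' L' := by
    rw [Module.finrank_mul_finrank, ← Module.finrank_mul_finrank K L L', mul_comm]
    exact Nat.mul_le_mul_left _ hε
  rw [← Finset.sum_div, ← Finset.sum_div, h0, h0', ← mul_div_assoc,
    div_le_div_iff₀ (by exact_mod_cast Module.finrank_pos) (by exact_mod_cast Module.finrank_pos)]
  have h1 := Nat.mul_le_mul_right (Module.finrank K L) hsum
  have h2 := Nat.mul_le_mul_right
    (∑ i ∈ Finset.range n, Nat.card (ramificationGroup A L (i + 1))) hdeg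
  have h3 := h1.trans (le_of_eq_of_le (by ring) h2)
  have h4 : (_ : ℚ) ≤ _ := Nat.cast_le.2 h3
  push_cast at h4
  linarith

end Comparison

/-! ### The residue field of K' -/

section ResidueField

variable {K K' : Type*} [Field K] [Field K'] [Algebra K K'] [Algebra.IsAlgebraic K K']
  {A : ValuationSubring K} {A' : ValuationSubring K'} [IsDiscreteValuationRing A]

omit [Algebra.IsAlgebraic K K'] in
theorem exists_aeval_eq_zero_map_residue_ne_zero {x : K'} (hx : IsAlgebraic K x) :
    ∃ f : A[X], eval₂ ((algebraMap K K').comp (algebraMap A K)) x f = 0 ∧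
      f.map (residue A) ≠ 0 := by
  obtain ⟨ϖ, hϖ⟩ := IsDiscreteValuationRing.exists_irreducible A
  let : Algebra A K' := ((algebraMap K K').comp (algebraMap A K)).toAlgebra
  have : IsScalarTower A K K' := IsScalarTower.of_algebraMap_eq fun _ => rfl
  obtain ⟨f, hf0, hf⟩ := (IsFractionRing.isAlgebraic_iff A K K').2 hx
  have hC : Prime (C ϖ : A[X]) := prime_C_iff.2 hϖ.prime
  -- Removing all powers of ϖ from a relation over A leaves one that survives reduction.
  obtain ⟨n, g, hg, rfl⟩ := WfDvdMonoid.max_power_factor hf0 hC.irreducible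
  refine ⟨g, ?_, fun h => hg ?_⟩
  · rw [map_mul, map_pow, aeval_C] at hf
    refine (mul_eq_zero.1 hf).resolve_left (pow_ne_zero _ ?_)
    exact (map_ne_zero (algebraMap K K')).2 ((map_ne_zero_iff (algebraMap A K)
      (FaithfulSMul.algebraMap_injective A K)).2 hϖ.ne_zero)
  · rw [C_dvd_iff_dvd_coeff]
    intro i
    have := congrArg (fun q => coeff q i) h
    simp only [coeff_map, coeff_zero, residue_eq_zero_iff] at this
    rwa [(IsDiscreteValuationRing.irreducible_iff_uniformizer _).1 hϖ,
      Ideal.mem_span_singleton] at this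

theorem isAlgClosed_residueField [IsAlgClosed (ResidueField A)]
    (hAA' : A'.comap (algebraMap K K') = A) : IsAlgClosed (ResidueField A') := by
  have hmem : ∀ a : K, algebraMap K K' a ∈ A' ↔ a ∈ A := fun a => by
    rw [← hAA', ValuationSubring.mem_comap]
  let φ : A →+* A' := ((algebraMap K K').comp (algebraMap A K)).codRestrict A'.toSubring
    fun a => (hmem a).2 a.2
  have hφ : ∀ a, ((φ a : A') : K') = algebraMap K K' a := fun _ => rfl
  have hloc : IsLocalHom φ := ⟨fun a ha => by
    obtain ⟨b, hb⟩ := ha.exists_right_inv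
    have hab : algebraMap K K' a * (b : K') = 1 := by
      rw [← hφ]
      exact congrArg Subtype.val hb
    have ha0 : (a : K) ≠ 0 := fun h0 => by
      rw [h0, map_zero, zero_mul] at hab
      exact zero_ne_one hab
    have hinv : (a : K)⁻¹ ∈ A := (hmem _).1 <| by
      rw [map_inv₀, inv_eq_of_mul_eq_one_right hab]
      exact b.2
    exact IsUnit.of_mul_eq_one ⟨_, hinv⟩ (Subtype.ext (mul_inv_cancel₀ ha0))⟩
  let : Algebra (ResidueField A) (ResidueField A') := (ResidueField.map φ).toAlgebra
  have hint : Algebra.IsIntegral (ResidueField A) (ResidueField A') := by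
    refine ⟨fun y => ?_⟩
    obtain ⟨x, rfl⟩ := residue_surjective y
    obtain ⟨f, hf, hf0⟩ := exists_aeval_eq_zero_map_residue_ne_zero (A := A)
      (Algebra.IsAlgebraic.isAlgebraic (R := K) (x : K'))
    refine IsAlgebraic.isIntegral ⟨_, hf0, ?_⟩
    have h1 : eval₂ φ x f = 0 := by
      apply Subtype.val_injective
      have := hom_eval₂ f φ A'.subtype x
      exact this.trans hf
    have h2 : (algebraMap (ResidueField A) (ResidueField A')).comp (residue A) =
        (residue A').comp φ := rfl
    rw [aeval_def, eval₂_map, h2, ← hom_eval₂, h1, map_zero]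
  let e := RingEquiv.ofBijective _ (IsAlgClosed.algebraMap_bijective_of_isIntegral
    (k := ResidueField A) (K := ResidueField A'))
  refine IsAlgClosed.of_exists_root _ fun q _ hq => ?_
  obtain ⟨z, hz⟩ := IsAlgClosed.exists_root (q.map (e.symm : ResidueField A' →+* ResidueField A))
    (by rw [degree_map]; exact hq.degree_pos.ne')
  refine ⟨e z, ?_⟩
  have h3 := congrArg e hz
  rw [eval_map, map_zero] at h3
  have h4 := hom_eval₂ q (e.symm : ResidueField A' →+* ResidueField A)
    (e : ResidueField A →+* ResidueField A') z
  rw [RingEquiv.comp_symm] at h4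
  exact h4.symm.trans h3

end ResidueField

/-! ### The field cut out by ρ, with K possibly imperfect -/

section CutOutField

variable {K Ω : Type*} [Field K] [Field Ω] [Algebra K Ω] [IsAlgClosure K Ω]
  {F : Type*} [Field F] {r : ℕ}

omit [IsAlgClosure K Ω] in
theorem exists_fixingSubgroup_le_ker [TopologicalSpace F] [DiscreteTopology F]
    {ρ : Gal(Ω/K) →* GL (Fin r) F} (hρ : Continuous ρ) :
    ∃ E : IntermediateField K Ω, FiniteDimensional K E ∧ E.fixingSubgroup ≤ ρ.ker := by
  refine (krullTopology_mem_nhds_one_iff K Ω (ρ.ker : Set Gal(Ω/K))).1 ?_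
  refine (IsOpen.preimage hρ (isOpen_discrete ({1} : Set (GL (Fin r) F)))).mem_nhds ?_
  simp

theorem mem_of_forall_fixingSubgroup {E : IntermediateField K Ω} {x : Ω} (hx : IsSeparable K x)
    (h : ∀ σ ∈ E.fixingSubgroup, σ x = x) : x ∈ E := by
  have : IsAlgClosed Ω := IsAlgClosure.isAlgClosed K
  have : Algebra.IsAlgebraic K Ω := IsAlgClosure.isAlgebraic
  have : Algebra.IsAlgebraic E Ω := Algebra.IsAlgebraic.tower_top (K := K) E
  have : Normal E Ω := normal_iff.2 fun y =>
    ⟨Algebra.IsIntegral.isIntegral y, IsAlgClosed.splits _⟩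
  have hxE : x ∈ separableClosure E Ω := mem_separableClosure_iff.2 (hx.tower_top E)
  have hb : (⟨x, hxE⟩ : separableClosure E Ω) ∈ (⊥ : IntermediateField E (separableClosure E Ω)) := by
    rw [InfiniteGalois.mem_bot_iff_fixed]
    intro f
    apply Subtype.val_injective
    have h1 := AlgEquiv.liftNormal_commutes f Ω ⟨x, hxE⟩
    refine h1.symm.trans (h ((f.liftNormal Ω).restrictScalars K) ?_)
    exact fun y => (f.liftNormal Ω).commutes y
  obtain ⟨y, hy⟩ := IntermediateField.mem_bot.1 hb
  have := congrArg Subtype.val hy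
  rw [← show (y : Ω) = x from this]
  exact y.2

theorem splittingField_le {ρ : Gal(Ω/K) →* GL (Fin r) F} {E : IntermediateField K Ω}
    (hE : E.fixingSubgroup ≤ ρ.ker) : splittingField ρ ≤ E := fun _ hx =>
  mem_of_forall_fixingSubgroup (mem_separableClosure_iff.1 hx.2) fun σ hσ =>
    (IntermediateField.mem_fixedField_iff _ _).1 hx.1 σ (hE hσ)

theorem finiteDimensional_splittingField {ρ : Gal(Ω/K) →* GL (Fin r) F}
    {E : IntermediateField K Ω} [FiniteDimensional K E] (hE : E.fixingSubgroup ≤ ρ.ker) :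
    FiniteDimensional K (splittingField ρ) :=
  FiniteDimensional.of_injective (IntermediateField.inclusion (splittingField_le hE)).toLinearMap
    (IntermediateField.inclusion_injective (splittingField_le hE))

theorem isGalois_splittingField (ρ : Gal(Ω/K) →* GL (Fin r) F) :
    IsGalois K (splittingField ρ) := by
  have : Algebra.IsSeparable K (splittingField ρ) :=
    (le_separableClosure_iff _ _ _).1 inf_le_right
  exact ⟨⟩

/-- Some Frobenius power of y is separable and still fixed by the kernel, hence fixed by σ;
Frobenius is injective. -/
theorem eq_of_mem_fixedField_ker {ρ : Gal(Ω/K) →* GL (Fin r) F} {σ : Gal(Ω/K)}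
    (hσ : ∀ x ∈ splittingField ρ, σ x = x) {y : Ω}
    (hy : y ∈ IntermediateField.fixedField ρ.ker) : σ y = y := by
  have : Algebra.IsAlgebraic K Ω := IsAlgClosure.isAlgebraic
  obtain ⟨n, z, hz⟩ := IsPurelyInseparable.pow_mem (separableClosure K Ω) (ringExpChar Ω) y
  have : ExpChar Ω (ringExpChar Ω) := inferInstance
  have h1 : y ^ ringExpChar Ω ^ n ∈ splittingField ρ := by
    refine ⟨pow_mem hy _, ?_⟩
    rw [← hz]
    exact z.2
  have h2 := hσ _ h1
  rw [map_pow] at h2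
  exact iterateFrobenius_inj Ω (ringExpChar Ω) n h2

/-- On the finite normal closure N of E, the Galois correspondence shows that σ agrees with some τ
in the kernel. Then τ⁻¹σ fixes N ⊇ E and so lies in the kernel too. -/
theorem map_eq_one_of_forall_splittingField {ρ : Gal(Ω/K) →* GL (Fin r) F}
    {E : IntermediateField K Ω} [FiniteDimensional K E] (hE : E.fixingSubgroup ≤ ρ.ker)
    {σ : Gal(Ω/K)} (hσ : ∀ x ∈ splittingField ρ, σ x = x) : ρ σ = 1 := by
  have : Normal K Ω := IsAlgClosure.normal K Ω
  let N := IntermediateField.normalClosure K E Ω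
  have hN : N.fixingSubgroup ≤ ρ.ker :=
    (IntermediateField.fixingSubgroup_antitone E.le_normalClosure).trans hE
  let R : Gal(Ω/K) →* Gal(N/K) := AlgEquiv.restrictNormalHom N
  have hR : ∀ (τ : Gal(Ω/K)) (x : N), ((R τ x : N) : Ω) = τ x := fun τ x =>
    AlgEquiv.restrictNormal_commutes τ N x
  have h1 : R σ ∈ ρ.ker.map R := by
    rw [← IntermediateField.fixingSubgroup_fixedField (ρ.ker.map R)]
    rw [IntermediateField.mem_fixingSubgroup_iff]
    intro x hx
    apply Subtype.val_injective
    rw [hR]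
    refine eq_of_mem_fixedField_ker hσ ((IntermediateField.mem_fixedField_iff _ _).2 fun τ hτ => ?_)
    rw [← hR]
    exact congrArg _ ((IntermediateField.mem_fixedField_iff _ _).1 hx _
      (Subgroup.mem_map_of_mem R hτ))
  obtain ⟨τ, hτ, hτσ⟩ := h1
  have h2 : τ⁻¹ * σ ∈ N.fixingSubgroup := by
    rw [IntermediateField.mem_fixingSubgroup_iff]
    intro x hx
    have h3 : R (τ⁻¹ * σ) = 1 := by rw [map_mul, map_inv, hτσ, inv_mul_cancel]
    rw [← hR _ ⟨x, hx⟩, h3]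
    rfl
  have h4 : ρ (τ⁻¹ * σ) = 1 := hN h2
  rw [map_mul, map_inv, show ρ τ = 1 from hτ, inv_one, one_mul] at h4
  exact h4

end CutOutField

/-! ### Vanishing of the higher ramification groups -/

section FiniteSupport

theorem exists_ramificationGroup_eq_bot {K : Type*} [Field K] (A : ValuationSubring K)
    [IsDiscreteValuationRing A] [IsAdicComplete (maximalIdeal A) A]
    [IsAlgClosed (ResidueField A)] (L : Type*) [Field L] [Algebra K L] [FiniteDimensional K L]
    [Algebra.IsSeparable K L] : ∃ N, ∀ i, N ≤ i → ramificationGroup A L i = ⊥ := by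
  have := isDiscreteValuationRing_integers A L
  obtain ⟨π, hπ, hm, hadj⟩ := exists_uniformizer A L
  have h : ∀ σ : Gal(L/K), ∃ n, ∀ i, n ≤ i → σ ∈ ramificationGroup A L i → σ = 1 := by
    intro σ
    by_cases hσ : σ = 1
    · exact ⟨0, fun _ _ _ => hσ⟩
    have hne : σ • π - π ≠ 0 := fun h0 => hσ <| smul_injective_of_adjoin_eq_top hadj <| by
      simpa using sub_eq_zero.1 h0
    obtain ⟨j, u, hj⟩ := IsDiscreteValuationRing.eq_unit_mul_pow_irreducible hne hπ
    refine ⟨j, fun i hi hmem => absurd ?_ hπ.not_isUnit⟩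
    have h1 := (pow_dvd_pow π (Nat.succ_le_succ hi)).trans
      ((mem_ramificationGroup_iff_dvd hm hadj i σ).1 hmem)
    rw [hj, Nat.succ_eq_add_one, pow_succ', mul_dvd_mul_iff_right (pow_ne_zero _ hπ.ne_zero)] at h1
    exact isUnit_of_dvd_unit h1 u.isUnit
  choose n hn using h
  refine ⟨Finset.univ.sup n, fun i hi => (Subgroup.eq_bot_iff_forall _).2 fun σ hσ => ?_⟩
  exact hn σ i ((Finset.le_sup (Finset.mem_univ σ)).trans hi) hσ

end FiniteSupport

/-! ### Codimension of fixed subspaces -/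

section FixedSubspace

variable {K K' Ω : Type*} [Field K] [Field K'] [Field Ω] [Algebra K Ω] [Algebra K' Ω]
  {F : Type*} [Field F] {r : ℕ}

theorem finrank_quotient_fixedSubspace_eq_zero {ρ : Gal(Ω/K) →* GL (Fin r) F}
    {H : Subgroup Gal(Ω/K)} (h : ∀ σ ∈ H, ρ σ = 1) :
    Module.finrank F ((Fin r → F) ⧸ fixedSubspace ρ H) = 0 := by
  have : fixedSubspace ρ H = ⊤ := eq_top_iff.2 fun v _ σ hσ => by simp [h σ hσ]
  rw [this]
  exact Module.finrank_zero_of_subsingleton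

theorem finrank_quotient_fixedSubspace_le {ρ : Gal(Ω/K) →* GL (Fin r) F}
    {ρ' : Gal(Ω/K') →* GL (Fin r) F} {H : Subgroup Gal(Ω/K)} {H' : Subgroup Gal(Ω/K')}
    (h : ∀ σ' ∈ H', ∃ σ ∈ H, ρ σ = ρ' σ') :
    Module.finrank F ((Fin r → F) ⧸ fixedSubspace ρ' H') ≤
      Module.finrank F ((Fin r → F) ⧸ fixedSubspace ρ H) := by
  have hle : fixedSubspace ρ H ≤ fixedSubspace ρ' H' := fun v hv σ' hσ' => by
    obtain ⟨σ, hσ, he⟩ := h σ' hσ'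
    rw [← he]
    exact hv σ hσ
  have h1 := Submodule.finrank_quotient_add_finrank (fixedSubspace ρ H)
  have h2 := Submodule.finrank_quotient_add_finrank (fixedSubspace ρ' H')
  have h3 := Submodule.finrank_mono hle
  omega

end FixedSubspace

/-! ### Restriction to K' and the final inequality -/

section Restriction

variable {K K' Ω : Type*} [Field K] [Field K'] [Field Ω] [Algebra K K'] [Algebra K Ω]
  [Algebra K' Ω] [IsScalarTower K K' Ω]
  {F : Type*} [Field F] {r : ℕ}

variable (K') in
/-- The restriction of a representation to the Galois group of an extension. -/
abbrev restrict (ρ : Gal(Ω/K) →* GL (Fin r) F) : Gal(Ω/K') →* GL (Fin r) F :=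
  ρ.comp (AlgEquiv.restrictScalarsHom K : Gal(Ω/K') →* Gal(Ω/K))

theorem exists_fixingSubgroup_le_ker_restrict [IsAlgClosure K Ω] {ρ : Gal(Ω/K) →* GL (Fin r) F}
    {E : IntermediateField K Ω} [FiniteDimensional K E] (hE : E.fixingSubgroup ≤ ρ.ker) :
    ∃ E' : IntermediateField K' Ω, FiniteDimensional K' E' ∧
      E'.fixingSubgroup ≤ (restrict K' ρ).ker := by
  have : Algebra.IsAlgebraic K Ω := IsAlgClosure.isAlgebraic
  let b := Module.finBasis K E
  let S : Set Ω := Set.range fun i => (b i : Ω)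
  refine ⟨IntermediateField.adjoin K' S, ?_, fun σ hσ => hE ?_⟩
  · have : Finite S := Set.finite_range _
    exact IntermediateField.finiteDimensional_adjoin fun x _ =>
      (Algebra.IsIntegral.isIntegral (R := K) x).tower_top
  · rw [IntermediateField.mem_fixingSubgroup_iff] at hσ ⊢
    intro x hx
    have hx' : ((∑ i, b.repr ⟨x, hx⟩ i • b i : E) : Ω) = x := by rw [b.sum_repr]
    rw [← hx', AddSubmonoidClass.coe_finsetSum, map_sum]
    refine Finset.sum_congr rfl fun i _ => ?_
    rw [IntermediateField.coe_smul, map_smul]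
    exact congrArg _ (hσ _ (IntermediateField.subset_adjoin K' S ⟨i, rfl⟩))

theorem splittingField_le_restrict (ρ : Gal(Ω/K) →* GL (Fin r) F) {x : Ω}
    (hx : x ∈ splittingField ρ) : x ∈ splittingField (restrict K' ρ) := by
  refine ⟨(IntermediateField.mem_fixedField_iff _ _).2 fun σ hσ => ?_,
    mem_separableClosure_iff.2 ((mem_separableClosure_iff.1 hx.2).tower_top K')⟩
  exact (IntermediateField.mem_fixedField_iff _ _).1 hx.1 (AlgEquiv.restrictScalarsHom K σ) hσ

theorem swanConductor_restrict_le [IsAlgClosure K Ω] [FiniteDimensional K K'] [IsAlgClosure K' Ω]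
    (A : ValuationSubring K) [IsDiscreteValuationRing A] [IsAdicComplete (maximalIdeal A) A]
    (A' : ValuationSubring K') [IsDiscreteValuationRing A'] [IsAdicComplete (maximalIdeal A') A']
    (hAA' : A'.comap (algebraMap K K') = A) [IsAlgClosed (ResidueField A)]
    [TopologicalSpace F] [DiscreteTopology F] {ρ : Gal(Ω/K) →* GL (Fin r) F}
    (hρ : Continuous ρ) :
    swanConductor A' (restrict K' ρ) ≤ (Module.finrank K K' : ℚ) * swanConductor A ρ := by
  have : IsAlgClosed (ResidueField A') := isAlgClosed_residueField hAA'
  obtain ⟨E, hEfin, hE⟩ := exists_fixingSubgroup_le_ker hρ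
  obtain ⟨E', hE'fin, hE'⟩ := exists_fixingSubgroup_le_ker_restrict (K' := K') hE
  set ρ' := restrict K' ρ with hρ'
  have : FiniteDimensional K (splittingField ρ) := finiteDimensional_splittingField hE
  have : FiniteDimensional K' (splittingField ρ') := finiteDimensional_splittingField hE'
  have : IsGalois K (splittingField ρ) := isGalois_splittingField ρ
  have : IsGalois K' (splittingField ρ') := isGalois_splittingField ρ'
  have : Normal K Ω := IsAlgClosure.normal K Ω
  have : Normal K' Ω := IsAlgClosure.normal K' Ω
  let incl : splittingField ρ →+* splittingField ρ' :=
    (algebraMap (splittingField ρ) Ω).codRestrict (splittingField ρ').toSubfield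
      fun x => splittingField_le_restrict ρ x.2
  let : Algebra (splittingField ρ) (splittingField ρ') := incl.toAlgebra
  have hincl : ∀ x : splittingField ρ, ((algebraMap _ (splittingField ρ') x :
    splittingField ρ') : Ω) = x := fun _ => rfl
  have : IsScalarTower K (splittingField ρ) (splittingField ρ') :=
    IsScalarTower.of_algebraMap_eq fun _ => rfl
  have : IsScalarTower K K' (splittingField ρ') :=
    IsScalarTower.of_algebraMap_eq fun x =>
      Subtype.val_injective (IsScalarTower.algebraMap_apply K K' Ω x)
  let res₀ : Gal(Ω/K') → Gal(splittingField ρ/K) := fun σ =>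
    AlgEquiv.restrictNormalHom (splittingField ρ) (AlgEquiv.restrictScalarsHom K σ)
  have hres₀ : ∀ σ x, ((res₀ σ x : splittingField ρ) : Ω) = σ x := fun σ x =>
    AlgEquiv.restrictNormal_commutes (AlgEquiv.restrictScalarsHom K σ) (splittingField ρ) x
  -- Restriction goes through an arbitrary lift to Ω; `hres'` shows that the choice is harmless.
  let res : Gal(splittingField ρ'/K') → Gal(splittingField ρ/K) := fun s => res₀ (s.liftNormal Ω)
  have hres : ∀ s x, algebraMap _ (splittingField ρ') (res s x) = s (algebraMap _ _ x) := by
    intro s x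
    apply Subtype.val_injective
    rw [hincl, hres₀]
    exact s.liftNormal_commutes Ω (algebraMap _ (splittingField ρ') x)
  have hres' : ∀ σ, res (AlgEquiv.restrictNormalHom (splittingField ρ') σ) = res₀ σ := by
    intro σ
    ext x
    refine Eq.trans ?_ (hres₀ σ x).symm
    refine (congrArg (Subtype.val) (hres _ x)).trans ?_
    exact AlgEquiv.restrictNormal_commutes σ (splittingField ρ') (algebraMap _ _ x)
  have hmem : ∀ a ∈ A, algebraMap K K' a ∈ A' := fun a ha => by
    rwa [← hAA', ValuationSubring.mem_comap] at ha
  let a : ℕ → ℚ := fun i => (Nat.card (ramificationGroup A' (splittingField ρ') (i + 1)) : ℚ) /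
    (Nat.card (ramificationGroup A' (splittingField ρ') 0) : ℚ)
  let b : ℕ → ℚ := fun i => (Nat.card (ramificationGroup A (splittingField ρ) (i + 1)) : ℚ) /
    (Nat.card (ramificationGroup A (splittingField ρ) 0) : ℚ)
  let c : ℕ → ℕ := fun i => Module.finrank F ((Fin r → F) ⧸ fixedSubspace ρ'
    ((ramificationGroup A' (splittingField ρ') (i + 1)).comap
      (AlgEquiv.restrictNormalHom (splittingField ρ'))))
  let d : ℕ → ℕ := fun i => Module.finrank F ((Fin r → F) ⧸ fixedSubspace ρ
    ((ramificationGroup A (splittingField ρ) (i + 1)).comap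
      (AlgEquiv.restrictNormalHom (splittingField ρ))))
  have ha : ∀ i, 0 ≤ a i := fun i => by positivity
  have hb : ∀ i, 0 ≤ b i := fun i => by positivity
  obtain ⟨N, hN⟩ := exists_ramificationGroup_eq_bot A (splittingField ρ)
  have hd : ∀ i, N ≤ i → d i = 0 := fun i hi => by
    refine finrank_quotient_fixedSubspace_eq_zero fun σ hσ => ?_
    rw [hN _ (Nat.le_succ_of_le hi), Subgroup.mem_comap, Subgroup.mem_bot] at hσ
    refine map_eq_one_of_forall_splittingField hE fun x hx => ?_
    have h1 := AlgEquiv.restrictNormal_commutes σ (splittingField ρ) ⟨x, hx⟩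
    refine h1.symm.trans ?_
    change algebraMap (splittingField ρ) Ω
      ((AlgEquiv.restrictNormalHom (splittingField ρ) σ) ⟨x, hx⟩) = x
    rw [hσ]
    rfl
  have hκ : (0 : ℚ) ≤ Module.finrank K K' := Nat.cast_nonneg _
  have hkey : ∀ m n, d n < c m → ∑ i ∈ Finset.range (m + 1), a i ≤
      (Module.finrank K K' : ℚ) * ∑ i ∈ Finset.range n, b i := by
    intro m n hmn
    have hex : ∃ s ∈ ramificationGroup A' (splittingField ρ') (m + 1),
        res s ∉ ramificationGroup A (splittingField ρ) (n + 1) := by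
      by_contra! hcon
      refine hmn.not_ge (finrank_quotient_fixedSubspace_le fun σ hσ =>
        ⟨AlgEquiv.restrictScalarsHom K σ, ?_, rfl⟩)
      have := hcon _ hσ
      rw [hres'] at this
      exact this
    obtain ⟨s, hs, hs'⟩ := hex
    exact sum_card_ramificationGroup_le hmem res hres m n s hs hs'
  have hswan : swanConductor A ρ = ∑ i ∈ Finset.range N, b i * d i := by
    refine finsum_eq_sum_of_support_subset _ fun i hi => ?_
    by_contra hiN
    refine hi ?_
    change b i * (d i : ℚ) = 0
    rw [hd i (by simpa using hiN), Nat.cast_zero, mul_zero]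
  have hswan' : swanConductor A' ρ' = ∑ᶠ i, a i * c i := rfl
  rw [hswan, hswan']
  -- If the support were infinite, the `finsum` would be 0 by convention, so nonnegativity of the
  -- right side suffices and finiteness over K' need not be proved.
  by_cases hfin : (Function.support fun i => a i * (c i : ℚ)).Finite
  · obtain ⟨M, hM⟩ := hfin.bddAbove
    rw [finsum_eq_sum_of_support_subset (s := Finset.range (M + 1)) _ fun i hi => by
      simpa [Nat.lt_succ_iff] using hM hi]
    exact sum_mul_le_of_partial_sums hb ha hκ hd hkey
  · rw [finsum_of_infinite_support hfin]
    exact mul_nonneg hκ (Finset.sum_nonneg fun i _ => mul_nonneg (hb i) (Nat.cast_nonneg _))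

end Restriction

end LocalSwan

theorem lemma2p4 {K K' Ω : Type*} [Field K] [Field K'] [Field Ω]
    [Algebra K K'] [FiniteDimensional K K']
    [Algebra K Ω] [Algebra K' Ω] [IsScalarTower K K' Ω] [IsAlgClosure K Ω] [IsAlgClosure K' Ω]
    (A : ValuationSubring K) [IsDiscreteValuationRing A]
    [IsAdicComplete (IsLocalRing.maximalIdeal A) A]
    (A' : ValuationSubring K') [IsDiscreteValuationRing A']
    [IsAdicComplete (IsLocalRing.maximalIdeal A') A']
    (hAA' : A'.comap (algebraMap K K') = A)
    (p : ℕ) (hp : p.Prime) [CharP (IsLocalRing.ResidueField A) p]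
    [IsAlgClosed (IsLocalRing.ResidueField A)]
    (l : ℕ) (hl : l.Prime) (hlp : l ≠ p)
    {F : Type*} [Field F] [Finite F] [CharP F l] [TopologicalSpace F] [DiscreteTopology F]
    (r : ℕ) (ρ : Gal(Ω/K) →* GL (Fin r) F) (hρ : Continuous ρ)
    (N : ℚ) (hN : LocalSwan.swanConductor A ρ ≤ N) :
    LocalSwan.swanConductor A' (ρ.comp (AlgEquiv.restrictScalarsHom K : Gal(Ω/K') →* Gal(Ω/K))) ≤
      (Module.finrank K K' : ℚ) * N :=
  (LocalSwan.swanConductor_restrict_le A A' hAA' hρ).trans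
    (mul_le_mul_of_nonneg_left hN (Nat.cast_nonneg _))
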